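/- Let $(X,d)$ be a compact metric space and let $T\colon X\to X$ be a continuous map such that $(X,T)$ is minimal, that is, for every $x\in X$ the orbit $\{T^n x : n\ge 0\}$ is dense in $X$. Then $(X,T)$ is logarithmically mean sensitive if and only if it is mean sensitive. Here $(X,T)$ is called mean sensitive if there exists $\varepsilon>0$ such that for every $x\in X$ and every $\delta>0$ there exists $y\in X$ with $d(x,y)<\delta$ and $$\limsup_{n\to\infty}\frac1n\sum_{k=1}^{n} d(T^{k-1}x,T^{k-1}y)\ge\varepsilon ,$$ and logarithmically mean sensitive if there exists $\varepsilon>0$ such that for every $x\in X$ and every $\delta>0$ there exists $y\in X$ with $d(x,y)<\delta$ and $$\limsup_{n\to\infty}\frac1{H_n}\sum_{k=1}^{n}\frac1k\, d(T^{k-1}x,T^{k-1}y)\ge\varepsilon ,\qquad H_n=\sum_{k=1}^{n}\frac1k .$$ -/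

import Mathlib

open Filter

/-- `(X, T)` is minimal: for every `x`, the forward orbit `{T ^ n x : n ≥ 0}` is dense in `X`. -/
def IsMinimalSystem {X : Type*} [TopologicalSpace X] (T : X → X) : Prop :=
  ∀ x : X, Dense (Set.range fun n : ℕ => T^[n] x)

/-- The Cesàro average `(1 / n) ∑_{k = 1}^n d(T ^ (k - 1) x, T ^ (k - 1) y)`. -/
noncomputable def cesaroDist {X : Type*} [MetricSpace X] (T : X → X) (x y : X) (n : ℕ) : ℝ :=
  (1 / (n : ℝ)) * ∑ k ∈ Finset.Icc 1 n, dist (T^[k - 1] x) (T^[k - 1] y)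

/-- The logarithmic average `(1 / H_n) ∑_{k = 1}^n (1 / k) d(T ^ (k - 1) x, T ^ (k - 1) y)`,
where `H_n = ∑_{k = 1}^n 1 / k` is the `n`-th harmonic number. -/
noncomputable def logDist {X : Type*} [MetricSpace X] (T : X → X) (x y : X) (n : ℕ) : ℝ :=
  (1 / ((harmonic n : ℚ) : ℝ)) *
    ∑ k ∈ Finset.Icc 1 n, (1 / (k : ℝ)) * dist (T^[k - 1] x) (T^[k - 1] y)

/-- Mean sensitivity. As `X` is compact, the averages are bounded (by the diameter of `X`), so
that the real-valued upper limit is the genuine one. -/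
def MeanSensitive {X : Type*} [MetricSpace X] [CompactSpace X] (T : X → X) : Prop :=
  ∃ ε : ℝ, 0 < ε ∧ ∀ x : X, ∀ δ : ℝ, 0 < δ →
    ∃ y : X, dist x y < δ ∧ ε ≤ limsup (fun n : ℕ => cesaroDist T x y n) atTop

/-- Logarithmic mean sensitivity. As for mean sensitivity, the averages are bounded because `X`
is compact. -/
def LogMeanSensitive {X : Type*} [MetricSpace X] [CompactSpace X] (T : X → X) : Prop :=
  ∃ ε : ℝ, 0 < ε ∧ ∀ x : X, ∀ δ : ℝ, 0 < δ →
    ∃ y : X, dist x y < δ ∧ ε ≤ limsup (fun n : ℕ => logDist T x y n) atTop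

/-! By partial summation, bounded partial sums stay bounded under the weights `1/k`, so a
logarithmic upper limit never exceeds the Cesàro one; this gives one implication. For the converse,
suppose logarithmic averages are small for all `y` near some `x`. Minimality spreads this to a
neighbourhood of every point. A small logarithmic average forces a small Cesàro average at some time
(`LogAverageLE.exists_sum_lt`), an open condition on pairs, so compactness bounds that time
(`exists_uniform_sum_orbitDist_lt`). Concatenating such blocks along the orbit of `(x, y)` bounds
the Cesàro upper limit (`sum_orbitDist_le_of_return`). -/

/-- The distances along the orbits of `x` and `y`. -/
def orbitDist {X : Type*} [MetricSpace X] (T : X → X) (x y : X) (k : ℕ) : ℝ :=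
  dist (T^[k] x) (T^[k] y)

/-- The harmonically weighted partial sum `∑_{k < n} a k / (k + 1)`. -/
noncomputable def logSum (a : ℕ → ℝ) (n : ℕ) : ℝ :=
  ∑ k ∈ Finset.range n, a k / ((k : ℝ) + 1)

/-- Eventually, the logarithmic averages of `a` are at most `c`. -/
def LogAverageLE (a : ℕ → ℝ) (c : ℝ) : Prop :=
  ∀ᶠ n in atTop, logSum a n ≤ c * logSum 1 n

/-! ### Logarithmic averages of real sequences -/

section Sequences

theorem logSum_add (a b : ℕ → ℝ) (n : ℕ) :
    logSum (fun k => a k + b k) n = logSum a n + logSum b n := by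
  simp [logSum, add_div, Finset.sum_add_distrib]

theorem logSum_sub (a b : ℕ → ℝ) (n : ℕ) :
    logSum (fun k => a k - b k) n = logSum a n - logSum b n := by
  simp [logSum, sub_div, Finset.sum_sub_distrib]

theorem logSum_const (c : ℝ) (n : ℕ) : logSum (fun _ => c) n = c * logSum 1 n := by
  simp [logSum, Finset.mul_sum, div_eq_mul_inv]

theorem logSum_mono {a b : ℕ → ℝ} (h : ∀ k, a k ≤ b k) (n : ℕ) : logSum a n ≤ logSum b n :=
  Finset.sum_le_sum fun k _ => div_le_div_of_nonneg_right (h k) (by positivity)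

theorem tendsto_logSum_one : Tendsto (logSum 1) atTop atTop :=
  Real.tendsto_sum_range_one_div_nat_succ_atTop

/-- A harmonically weighted sum is at most any bound of the unweighted partial sums. -/
theorem logSum_le_of_sum_le {b : ℕ → ℝ} {B : ℝ}
    (h : ∀ n, ∑ k ∈ Finset.range n, b k ≤ B) (n : ℕ) : logSum b n ≤ B := by
  -- Abel summation as an induction: the subtracted slack is nonnegative and shrinks with the
  -- weight.
  have key : ∀ n : ℕ, logSum b n ≤ B - (B - ∑ k ∈ Finset.range n, b k) / ((n : ℝ) + 1) := by
    intro n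
    induction n with
    | zero => simp [logSum]
    | succ n ih =>
      have h1 : logSum b (n + 1) = logSum b n + b n / ((n : ℝ) + 1) := by
        simp [logSum, Finset.sum_range_succ]
      have h2 := h (n + 1)
      have h3 : (B - ∑ k ∈ Finset.range (n + 1), b k) / (((n + 1 : ℕ) : ℝ) + 1) ≤
          (B - ∑ k ∈ Finset.range (n + 1), b k) / ((n : ℝ) + 1) :=
        div_le_div_of_nonneg_left (by linarith) (by positivity) (by push_cast; linarith)
      have h4 : (B - ∑ k ∈ Finset.range (n + 1), b k) / ((n : ℝ) + 1) =
          (B - ∑ k ∈ Finset.range n, b k) / ((n : ℝ) + 1) - b n / ((n : ℝ) + 1) := by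
        rw [Finset.sum_range_succ]
        ring
      linarith
  have h5 : 0 ≤ (B - ∑ k ∈ Finset.range n, b k) / ((n : ℝ) + 1) :=
    div_nonneg (by linarith [h n]) (by positivity)
  linarith [key n]

theorem LogAverageLE.add {a b : ℕ → ℝ} {c d : ℝ} (ha : LogAverageLE a c)
    (hb : LogAverageLE b d) : LogAverageLE (fun k => a k + b k) (c + d) := by
  filter_upwards [ha, hb] with n h1 h2
  rw [logSum_add]
  linarith

theorem LogAverageLE.mono {a b : ℕ → ℝ} {c : ℝ} (hb : LogAverageLE b c) (h : ∀ k, a k ≤ b k) :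
    LogAverageLE a c := by
  filter_upwards [hb] with n h1
  exact (logSum_mono h n).trans h1

/-- Sequences whose partial sums differ by a bounded amount have the same logarithmic averages in
the limit. -/
theorem LogAverageLE.of_sum_sub_le {a b : ℕ → ℝ} {c d B : ℝ} (hb : LogAverageLE b c) (hcd : c < d)
    (h : ∀ n, ∑ k ∈ Finset.range n, (a k - b k) ≤ B) : LogAverageLE a d := by
  filter_upwards [hb, tendsto_logSum_one.eventually_ge_atTop (B / (d - c))] with n h1 h2
  have h3 := logSum_le_of_sum_le h n
  rw [logSum_sub] at h3
  rw [div_le_iff₀ (by linarith)] at h2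
  linarith

theorem logAverageLE_const (c : ℝ) : LogAverageLE (fun _ => c) c :=
  Eventually.of_forall fun n => (logSum_const c n).le

/-- A small logarithmic average forces some Cesàro average to be small. -/
theorem LogAverageLE.exists_sum_lt {a : ℕ → ℝ} {c d : ℝ} (ha : LogAverageLE a c) (hcd : c < d) :
    ∃ n, 0 < n ∧ ∑ k ∈ Finset.range n, a k < d * n := by
  by_contra! hcon
  have h : ∀ n, ∑ k ∈ Finset.range n, (d - a k) ≤ 0 := by
    intro n
    rcases Nat.eq_zero_or_pos n with rfl | hn
    · simp
    · have := hcon n hn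
      simp only [Finset.sum_sub_distrib, Finset.sum_const, Finset.card_range, nsmul_eq_mul]
      linarith
  obtain ⟨n, h1, h2⟩ := (ha.and (tendsto_logSum_one.eventually_gt_atTop 0)).exists
  have h3 := logSum_le_of_sum_le h n
  rw [logSum_sub, logSum_const] at h3
  nlinarith

end Sequences

/-! ### Averages along orbits of pairs -/

section Orbits

variable {X : Type*} [MetricSpace X] (T : X → X)

theorem cesaroDist_eq (x y : X) (n : ℕ) :
    cesaroDist T x y n = (∑ k ∈ Finset.range n, orbitDist T x y k) / n := by
  rw [cesaroDist, Finset.range_eq_Ico, Finset.sum_Ico_eq_sum_range,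
    ← Finset.Ico_add_one_right_eq_Icc, Finset.sum_Ico_eq_sum_range]
  simp [orbitDist, div_eq_inv_mul]

theorem logDist_eq (x y : X) (n : ℕ) :
    logDist T x y n = logSum (orbitDist T x y) n / logSum 1 n := by
  have h : ((harmonic n : ℚ) : ℝ) = logSum 1 n := by
    simp [harmonic, logSum]
  rw [logDist, h, ← Finset.Ico_add_one_right_eq_Icc, Finset.sum_Ico_eq_sum_range]
  simp only [logSum, orbitDist, div_eq_inv_mul]
  simp [add_comm]

theorem orbitDist_nonneg (x y : X) (k : ℕ) : 0 ≤ orbitDist T x y k := dist_nonneg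

theorem orbitDist_comm (x y : X) : orbitDist T x y = orbitDist T y x :=
  funext fun _ => dist_comm _ _

theorem orbitDist_triangle (x y z : X) (k : ℕ) :
    orbitDist T x z k ≤ orbitDist T x y k + orbitDist T y z k := dist_triangle _ _ _

theorem orbitDist_iterate (x y : X) (m k : ℕ) :
    orbitDist T (T^[m] x) (T^[m] y) k = orbitDist T x y (m + k) := by
  simp only [orbitDist, ← Function.iterate_add_apply, add_comm]

variable {T}

theorem LogAverageLE.orbitDist_trans {x y z : X} {c d : ℝ} (h : LogAverageLE (orbitDist T x y) c)
    (h' : LogAverageLE (orbitDist T y z) d) : LogAverageLE (orbitDist T x z) (c + d) :=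
  (h.add h').mono (orbitDist_triangle T x y z)

theorem LogAverageLE.orbitDist_symm {x y : X} {c : ℝ} (h : LogAverageLE (orbitDist T x y) c) :
    LogAverageLE (orbitDist T y x) c := orbitDist_comm T x y ▸ h

/-- Only the first `m` terms are lost by shifting, a bounded change absorbed by `c < d`. -/
theorem LogAverageLE.of_iterate {x y : X} {m : ℕ} {c d : ℝ}
    (h : LogAverageLE (orbitDist T (T^[m] x) (T^[m] y)) c) (hcd : c < d) :
    LogAverageLE (orbitDist T x y) d := by
  refine h.of_sum_sub_le hcd (B := ∑ k ∈ Finset.range m, orbitDist T x y k) fun n => ?_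
  have h1 := Finset.sum_range_add (orbitDist T x y) m n
  have h2 : ∑ k ∈ Finset.range n, orbitDist T x y k ≤
      ∑ k ∈ Finset.range (m + n), orbitDist T x y k :=
    Finset.sum_le_sum_of_subset_of_nonneg (Finset.range_mono (by lia))
      fun k _ _ => orbitDist_nonneg T x y k
  simp only [Finset.sum_sub_distrib, orbitDist_iterate]
  linarith

theorem continuous_sum_orbitDist (hT : Continuous T) (n : ℕ) :
    Continuous fun p : X × X => ∑ k ∈ Finset.range n, orbitDist T p.1 p.2 k :=
  continuous_finsetSum _ fun k _ =>
    ((hT.iterate k).comp continuous_fst).dist ((hT.iterate k).comp continuous_snd)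

variable [CompactSpace X]

theorem orbitDist_le_diam (x y : X) (k : ℕ) :
    orbitDist T x y k ≤ Metric.diam (Set.univ : Set X) :=
  Metric.dist_le_diam_of_mem isCompact_univ.isBounded (Set.mem_univ _) (Set.mem_univ _)

theorem sum_orbitDist_le (x y : X) (s : Finset ℕ) :
    ∑ k ∈ s, orbitDist T x y k ≤ s.card * Metric.diam (Set.univ : Set X) := by
  simpa using Finset.sum_le_card_nsmul s _ _ fun k _ => orbitDist_le_diam (T := T) x y k

theorem LogAverageLE.iterate {x y : X} {c d : ℝ} (h : LogAverageLE (orbitDist T x y) c)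
    (hcd : c < d) (m : ℕ) : LogAverageLE (orbitDist T (T^[m] x) (T^[m] y)) d := by
  refine h.of_sum_sub_le hcd (B := m * Metric.diam (Set.univ : Set X)) fun n => ?_
  have h1 := Finset.sum_range_add (orbitDist T x y) m n
  have h2 := Finset.sum_range_add (orbitDist T x y) n m
  have h3 := sum_orbitDist_le (T := T) (T^[n] x) (T^[n] y) (Finset.range m)
  have h4 : 0 ≤ ∑ k ∈ Finset.range m, orbitDist T x y k :=
    Finset.sum_nonneg fun k _ => orbitDist_nonneg T x y k
  simp only [Finset.sum_sub_distrib, orbitDist_iterate, Finset.card_range] at h3 ⊢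
  rw [add_comm n m] at h2
  linarith

theorem cesaroDist_mem (x y : X) (n : ℕ) :
    cesaroDist T x y n ∈ Set.Icc 0 (Metric.diam (Set.univ : Set X)) := by
  have h := sum_orbitDist_le (T := T) x y (Finset.range n)
  rw [Finset.card_range] at h
  rw [cesaroDist_eq]
  refine ⟨div_nonneg (Finset.sum_nonneg fun k _ => orbitDist_nonneg T x y k) n.cast_nonneg,
    div_le_of_le_mul₀ n.cast_nonneg Metric.diam_nonneg (by linarith)⟩

theorem logSum_one_nonneg (n : ℕ) : 0 ≤ logSum 1 n :=
  Finset.sum_nonneg fun k _ => div_nonneg zero_le_one (by positivity)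

theorem logDist_mem (x y : X) (n : ℕ) :
    logDist T x y n ∈ Set.Icc 0 (Metric.diam (Set.univ : Set X)) := by
  have h := logSum_mono (orbitDist_le_diam (T := T) x y) n
  rw [logSum_const] at h
  rw [logDist_eq]
  exact ⟨div_nonneg (Finset.sum_nonneg fun k _ =>
    div_nonneg (orbitDist_nonneg T x y k) (by positivity)) (logSum_one_nonneg n),
    div_le_of_le_mul₀ (logSum_one_nonneg n) Metric.diam_nonneg h⟩

theorem isBoundedUnder_cesaroDist (x y : X) :
    IsBoundedUnder (· ≤ ·) atTop (cesaroDist T x y) :=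
  isBoundedUnder_of ⟨_, fun n => (cesaroDist_mem x y n).2⟩

theorem isCoboundedUnder_cesaroDist (x y : X) :
    IsCoboundedUnder (· ≤ ·) atTop (cesaroDist T x y) :=
  IsBoundedUnder.isCoboundedUnder_le (isBoundedUnder_of ⟨0, fun n => (cesaroDist_mem x y n).1⟩)

theorem isBoundedUnder_logDist (x y : X) :
    IsBoundedUnder (· ≤ ·) atTop (logDist T x y) :=
  isBoundedUnder_of ⟨_, fun n => (logDist_mem x y n).2⟩

theorem isCoboundedUnder_logDist (x y : X) :
    IsCoboundedUnder (· ≤ ·) atTop (logDist T x y) :=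
  IsBoundedUnder.isCoboundedUnder_le (isBoundedUnder_of ⟨0, fun n => (logDist_mem x y n).1⟩)

theorem logAverageLE_of_limsup_logDist_lt {x y : X} {c : ℝ}
    (h : limsup (fun n => logDist T x y n) atTop < c) : LogAverageLE (orbitDist T x y) c := by
  filter_upwards [eventually_lt_of_limsup_lt h (isBoundedUnder_logDist x y),
    tendsto_logSum_one.eventually_gt_atTop 0] with n h1 h2
  rw [logDist_eq, div_lt_iff₀ h2] at h1
  exact h1.le

theorem limsup_logDist_le {x y : X} {c : ℝ} (h : LogAverageLE (orbitDist T x y) c) :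
    limsup (fun n => logDist T x y n) atTop ≤ c := by
  refine limsup_le_of_le (isCoboundedUnder_logDist x y) ?_
  filter_upwards [h, tendsto_logSum_one.eventually_gt_atTop 0] with n h1 h2
  rwa [logDist_eq, div_le_iff₀ h2]

theorem limsup_cesaroDist_le {x y : X} {c d B : ℝ} (hcd : c < d)
    (h : ∀ n : ℕ, ∑ k ∈ Finset.range n, orbitDist T x y k ≤ c * n + B) :
    limsup (fun n => cesaroDist T x y n) atTop ≤ d := by
  refine limsup_le_of_le (isCoboundedUnder_cesaroDist x y) ?_
  filter_upwards [tendsto_natCast_atTop_atTop.eventually_ge_atTop (B / (d - c)),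
    eventually_gt_atTop 0] with n h1 h2
  rw [div_le_iff₀ (by linarith)] at h1
  rw [cesaroDist_eq, div_le_iff₀ (by exact_mod_cast h2)]
  linarith [h n]

theorem limsup_logDist_le_limsup_cesaroDist (x y : X) :
    limsup (fun n => logDist T x y n) atTop ≤ limsup (fun n => cesaroDist T x y n) atTop := by
  refine le_of_forall_gt_imp_ge_of_dense fun d hd => ?_
  obtain ⟨c, hc, hcd⟩ := exists_between hd
  obtain ⟨N, hN⟩ := eventually_atTop.1
    (eventually_lt_of_limsup_lt hc (isBoundedUnder_cesaroDist x y))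
  have hc0 : 0 ≤ c := (cesaroDist_mem (T := T) x y N).1.trans (hN N le_rfl).le
  have hB : 0 ≤ N * Metric.diam (Set.univ : Set X) :=
    mul_nonneg N.cast_nonneg Metric.diam_nonneg
  -- Past `N` the partial sums lie below those of the constant `c`; before `N` the diameter bounds
  -- the excess.
  refine limsup_logDist_le ((logAverageLE_const c).of_sum_sub_le hcd
    (B := N * Metric.diam (Set.univ : Set X)) fun n => ?_)
  simp only [Finset.sum_sub_distrib, Finset.sum_const, Finset.card_range, nsmul_eq_mul]
  rcases lt_or_ge n N with hn | hn
  · have h1 := sum_orbitDist_le (T := T) x y (Finset.range n)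
    have h2 : (n : ℝ) * Metric.diam (Set.univ : Set X) ≤ N * Metric.diam (Set.univ : Set X) :=
      mul_le_mul_of_nonneg_right (by exact_mod_cast hn.le) Metric.diam_nonneg
    have h3 : 0 ≤ (n : ℝ) * c := by positivity
    rw [Finset.card_range] at h1
    linarith
  · have h1 := hN n hn
    rcases Nat.eq_zero_or_pos n with rfl | h0
    · simpa using hB
    · rw [cesaroDist_eq, div_lt_iff₀ (by exact_mod_cast h0)] at h1
      linarith

/-- If along an orbit of pairs one always finds a small Cesàro average of bounded length, then the
Cesàro averages are eventually small. -/
theorem sum_orbitDist_le_of_return {x y : X} {c : ℝ} {N : ℕ} (hc : 0 ≤ c)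
    (h : ∀ m, ∃ n, 0 < n ∧ n ≤ N ∧
      ∑ k ∈ Finset.range n, orbitDist T (T^[m] x) (T^[m] y) k < c * n) (n m : ℕ) :
    ∑ k ∈ Finset.range n, orbitDist T (T^[m] x) (T^[m] y) k ≤
      c * n + N * Metric.diam (Set.univ : Set X) := by
  induction n using Nat.strong_induction_on generalizing m with
  | _ n ih =>
    obtain ⟨r, hr0, hrN, hr⟩ := h m
    -- A final incomplete block costs at most `N` diameters; otherwise a full block is split off.
    rcases lt_or_ge n r with hn | hn
    · have h1 := sum_orbitDist_le (T := T) (T^[m] x) (T^[m] y) (Finset.range n)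
      have h2 : (n : ℝ) * Metric.diam (Set.univ : Set X) ≤ N * Metric.diam (Set.univ : Set X) :=
        mul_le_mul_of_nonneg_right (by exact_mod_cast (hn.le.trans hrN)) Metric.diam_nonneg
      have h3 : 0 ≤ c * (n : ℝ) := by positivity
      rw [Finset.card_range] at h1
      linarith
    · obtain ⟨s, rfl⟩ := Nat.exists_eq_add_of_le hn
      have h1 := ih s (by lia) (m + r)
      rw [Finset.sum_range_add]
      simp only [orbitDist_iterate, ← add_assoc] at h1 hr ⊢
      push_cast
      linarith

end Orbits

/-! ### Minimality and compactness -/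

section Minimal

variable {X : Type*} [MetricSpace X] {T : X → X}

/-- In a minimal system, smallness of the logarithmic averages near one point spreads to every
point. -/
theorem IsMinimalSystem.eventually_logAverageLE (hT : Continuous T) (hmin : IsMinimalSystem T)
    {x : X} {c d δ : ℝ} (hδ : 0 < δ) (hcd : c + c < d)
    (h : ∀ y, dist x y < δ → LogAverageLE (orbitDist T x y) c) (u : X) :
    ∀ᶠ v in nhds u, LogAverageLE (orbitDist T u v) d := by
  obtain ⟨_, ⟨m, rfl⟩, hm⟩ :=
    (hmin u).exists_mem_open Metric.isOpen_ball ⟨x, Metric.mem_ball_self hδ⟩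
  filter_upwards [(hT.iterate m).continuousAt.preimage_mem_nhds (Metric.isOpen_ball.mem_nhds hm)]
    with v hv
  exact ((h _ (Metric.mem_ball'.1 hm)).orbitDist_symm.orbitDist_trans
    (h _ (Metric.mem_ball'.1 hv))).of_iterate hcd

/-- If the logarithmic averages of `orbitDist T` are small near the diagonal, then pairs with small
logarithmic averages have a small Cesàro average of uniformly bounded length. -/
theorem exists_uniform_sum_orbitDist_lt [CompactSpace X] (hT : Continuous T) {b c d : ℝ} (hd : c + b + c < d)
    (h : ∀ u : X, ∀ᶠ v in nhds u, LogAverageLE (orbitDist T u v) c) :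
    ∃ N : ℕ, ∀ u v, LogAverageLE (orbitDist T u v) b →
      ∃ n, 0 < n ∧ n ≤ N ∧ ∑ k ∈ Finset.range n, orbitDist T u v k < d * n := by
  let K : Set (X × X) := {p | LogAverageLE (orbitDist T p.1 p.2) b}
  -- `K` need not be closed: a limit pair is compared with a nearby pair of `K`, costing `c` in each
  -- coordinate.
  have hK : closure K ⊆
      ⋃ N : ℕ, {p | ∃ n, 0 < n ∧ n ≤ N ∧ ∑ k ∈ Finset.range n, orbitDist T p.1 p.2 k < d * n} := by
    rintro ⟨u, v⟩ huv
    obtain ⟨⟨u', v'⟩, hb, hu, hv⟩ := ((mem_closure_iff_frequently.1 huv).and_eventually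
      ((h u).prod_nhds (h v))).exists
    obtain ⟨n, h0, hn⟩ :=
      ((hu.orbitDist_trans hb).orbitDist_trans hv.orbitDist_symm).exists_sum_lt hd
    exact Set.mem_iUnion.2 ⟨n, n, h0, le_rfl, hn⟩
  obtain ⟨N, hN⟩ := isClosed_closure.isCompact.elim_directed_cover _ (fun N => by
    simp only [Set.ofPred_exists, Set.ofPred_and]
    exact isOpen_iUnion fun n => isOpen_const.inter (isOpen_const.inter
      (isOpen_lt (continuous_sum_orbitDist hT n) continuous_const))) hK
    (Monotone.directed_le fun N M hNM p ⟨n, h0, hn, hs⟩ => ⟨n, h0, hn.trans hNM, hs⟩)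
  exact ⟨N, fun u v huv => hN (subset_closure (show (u, v) ∈ K from huv))⟩

end Minimal

theorem mainTheorem5 {X : Type*} [MetricSpace X] [CompactSpace X] (T : X → X)
    (hT : Continuous T) (hmin : IsMinimalSystem T) :
    LogMeanSensitive T ↔ MeanSensitive T := by
  constructor
  · rintro ⟨ε, hε, h⟩
    refine ⟨ε, hε, fun x δ hδ => ?_⟩
    obtain ⟨y, hy, hl⟩ := h x δ hδ
    exact ⟨y, hy, hl.trans (limsup_logDist_le_limsup_cesaroDist x y)⟩
  · rintro ⟨ε, hε, h⟩
    by_contra hlog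
    simp only [LogMeanSensitive, not_exists, not_and, not_forall, not_le] at hlog
    -- With `e = ε / 20`: `e + e < 3e` near any point, `2e` along the orbit, `3e + 2e + 3e < 9e` for
    -- blocks, and a final bound `10e = ε / 2`.
    obtain ⟨x, δ, hδ, hx⟩ := hlog (ε / 20) (by positivity)
    have hx' : ∀ y, dist x y < δ → LogAverageLE (orbitDist T x y) (ε / 20) :=
      fun y hy => logAverageLE_of_limsup_logDist_lt (hx y hy)
    obtain ⟨N, hN⟩ := exists_uniform_sum_orbitDist_lt hT (b := 2 * (ε / 20)) (c := 3 * (ε / 20))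
      (d := 9 * (ε / 20)) (by linarith)
      (hmin.eventually_logAverageLE hT hδ (by linarith) hx')
    obtain ⟨y, hy, hε'⟩ := h x δ hδ
    have hs := sum_orbitDist_le_of_return (by positivity)
      fun m => hN _ _ ((hx' y hy).iterate (by linarith) m)
    have := limsup_cesaroDist_le (d := 10 * (ε / 20)) (by linarith) fun n => hs n 0
    simp only [Function.iterate_zero, id_eq] at this
    linarith
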